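/- **Model.** Let $P=(v_1,\dots,v_n)$, $n\ge 1$, be a path. Time is divided into slots $0,1,2,\dots$, and in each slot every vertex either sends a message, listens, or stays idle; sending and listening cost one unit of energy, idling is free. A vertex that listens hears the multiset of all messages sent in that slot by its neighbours (no collisions); a vertex that sends or idles gets no feedback. Messages come from a countable set. The source $v_1$ holds a payload $m$ from a set $M$ with at least two elements. In a randomized $\mathsf{LOCAL}$ algorithm all vertices run the same program (which may depend on $n$). The random strings of the vertices are private, independent and identically distributed, from an arbitrary distribution, and the program is measurable in the random string. What a vertex does in a slot depends only on its random string, its own input ($m$ for the source, nothing for the others), the slot number and the feedback it has had so far; in particular no vertex knows its position. From the same data each vertex also computes an output, which is either "nothing yet" or a payload. A run *succeeds* if every vertex other than $v_1$ eventually outputs a payload and the first payload that it outputs is $m$. A vertex *receives* $m$ when it first outputs $m$, and $v_1$ has received $m$ from the start. The energy that a vertex spends before receiving $m$ is the number of slots in which it sends or listens and at whose beginning it has not yet received $m$ (so the slot in which it receives $m$ is counted; if it never receives $m$, all its energy is counted). **Theorem.** Let $\mathcal A$ be a randomized $\mathsf{LOCAL}$ algorithm that solves Broadcast on $P$ with source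 $v_1$, that is, for every payload in $M$ the run succeeds with probability at least $15/16$. Then for every payload $m\in M$, with probability at least $1/2$ at least one vertex spends at least $\frac15\log_2 n$ energy before receiving $m$. -/

import Mathlib

open MeasureTheory
open scoped ENNReal

namespace RadioLocal

/-- What a device may do in one time slot. Sending and listening cost one unit of energy each,
remaining idle is free. -/
inductive Action (Msg : Type*) where
  | send (a : Msg) : Action Msg
  | listen : Action Msg
  | idle : Action Msg

/-- The message put on the channel by an action, if any. -/
def Action.sent {Msg : Type*} : Action Msg → Option Msg
  | .send a => some a
  | .listen => none
  | .idle => none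

/-- The feedback a device got from the channel in the past slots, one entry per slot in order.
An entry is `none` if the device sent or was idle (no feedback), and `some S` if it listened
and `S` is the collection of all messages sent by its neighbours in that slot. -/
abbrev History (Msg : Type*) := List (Option (Multiset Msg))

/-- A randomized algorithm; all devices run the same one. `R` is the space of private random
strings, `M` the set of possible payloads, `Msg` the set of channel messages. In each slot a
device acts on the basis of its random string, its input (`some m` for the source holding the
payload `m`, `none` for every other device) and its history alone; the number of the current
slot is the length of the history. The value of `out` is `none` as long as the device has not
learned the payload, and the payload that it has learned afterwards. -/
structure Algorithm (R M Msg : Type*) [MeasurableSpace R] where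
  act : R → Option M → History Msg → Action Msg
  out : R → Option M → History Msg → Option M
  measurableSet_act : ∀ (x : Option M) (h : History Msg) (a : Action Msg),
    MeasurableSet {r | act r x h = a}
  measurableSet_out : ∀ (x : Option M) (h : History Msg) (o : Option M),
    MeasurableSet {r | out r x h = o}

namespace Algorithm

variable {R M Msg V : Type*} [MeasurableSpace R] [Fintype V]
  (A : Algorithm R M Msg) (G : SimpleGraph V) (src : V) (m : M) (ω : V → R)

open Classical in
/-- The input of vertex `v` if `src` is the source and holds the payload `m`. -/
noncomputable def input (src : V) (m : M) (v : V) : Option M :=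
  if v = src then some m else none

open Classical in
/-- The feedback of the `LOCAL` channel to `v`, if the vertices act as in `a`: a listener hears
every message sent by a neighbour, the others get no feedback. -/
noncomputable def feedback (G : SimpleGraph V) (a : V → Action Msg) (v : V) :
    Option (Multiset Msg) :=
  match a v with
  | .listen => some ((G.neighborFinset v).val.filterMap fun u => (a u).sent)
  | .send _ => none
  | .idle => none

/-- The history of `v` at the beginning of slot `t`, when the random strings are `ω`. -/
noncomputable def hist : ℕ → V → History Msg
  | 0, _ => []
  | t + 1, v =>
      hist t v ++ [feedback G (fun u => A.act (ω u) (input src m u) (hist t u)) v]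

/-- The action of `v` in slot `t`. -/
noncomputable def actionAt (t : ℕ) (v : V) : Action Msg :=
  A.act (ω v) (input src m v) (A.hist G src m ω t v)

/-- The output of `v` at the beginning of slot `t`. -/
noncomputable def outAt (t : ℕ) (v : V) : Option M :=
  A.out (ω v) (input src m v) (A.hist G src m ω t v)

/-- At the beginning of slot `t`, vertex `v` has received `m`. The source has it from the start. -/
def HasReceived (t : ℕ) (v : V) : Prop :=
  v = src ∨ ∃ s ≤ t, A.outAt G src m ω s v = some m

/-- The energy that `v` spends before it has received `m`: the number of slots in which it sends
or listens and at whose beginning it has not yet received `m`. The slot in which it receives `m`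
is thus counted; if it never receives `m`, all its energy is counted. -/
noncomputable def energyBeforeReceiving (v : V) : ℕ∞ :=
  Set.encard {t : ℕ | A.actionAt G src m ω t v ≠ .idle ∧ ¬ A.HasReceived G src m ω t v}

/-- In the run on `ω`, every vertex other than the source eventually outputs a payload, and the
first payload it outputs is `m`. -/
def Succeeds : Prop :=
  ∀ v, v ≠ src → ∃ t, A.outAt G src m ω t v = some m ∧
    ∀ s < t, A.outAt G src m ω s v = none

/-- On `G` with source `src`, whatever the payload is, the algorithm informs all vertices with
probability at least `p`, when the private random strings are independent with law `ρ`. -/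
def SolvesBroadcast (ρ : Measure R) (p : ℝ≥0∞) : Prop :=
  ∀ m : M, p ≤ Measure.pi (fun _ : V => ρ) {ω | A.Succeeds G src m ω}

end Algorithm

end RadioLocal

/-! Until news from the source reaches a vertex, the vertex behaves as in a run without a source. If
the runs for two payloads on the same random strings both succeed, news must have reached every
vertex by its first output (`covered_of_succeeds`). `flood` overestimates the spread of news: it
enters any active vertex next to an informed one, whoever sends or listens. So it suffices that in a
source-free run on `32 ^ k` vertices, flooded from both ends, with probability at least 5/8 some
vertex is not reached within its first `k` active slots (`measure_covered_le`).

The induction on `k` takes place on cycles, which are rotation invariant. Cut a cycle into 32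
blocks. Until some vertex exceeds `k` active slots, a block that is not covered within `k` slots on
its own keeps an uninformed vertex. If there is such a block among the first three and another among
the last three, everything between the two uninformed vertices is uninformed as well; a vertex there
that is among the first to spend a `(k + 1)`-st active slot learns nothing from it and needs one
more (`not_covered_succ_of_isFirst`). If `x` bounds the probability that a block is covered,
independence bounds the failure at each end by `x ^ 3`, and rotation bounds the chance that the
first vertices miss the middle by 6/32. The value `x = 3/8` satisfies `2 * x ^ 3 + 6/32 ≤ x`. -/

namespace RadioLocal

/-! ### Deterministic spread of information on the line -/

section Flood

/-- The spread of information from outside the segment `[a, b)` of the integer line, if `act t i`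
tells whether `i` is active in slot `t`: the outside has it from the start, and an active vertex
gets it when a neighbour has it. -/
def flood (act : ℕ → ℤ → Prop) (a b : ℤ) : ℕ → ℤ → Prop
  | 0, i => i < a ∨ b ≤ i
  | t + 1, i => flood act a b t i ∨
      (act t i ∧ (flood act a b t (i - 1) ∨ flood act a b t (i + 1)))

open Classical in
/-- The number of slots before `t` in which `i` is active. -/
noncomputable def activity (act : ℕ → ℤ → Prop) (t : ℕ) (i : ℤ) : ℕ :=
  Nat.count (fun s => act s i) t

/-- Every vertex of `[a, b)` gets the information from outside within its first `k` active
slots. -/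
def Covered (act : ℕ → ℤ → Prop) (a b : ℤ) (k : ℕ) : Prop :=
  ∀ i, a ≤ i → i < b → ∃ t, flood act a b t i ∧ activity act t i ≤ k

variable {act act' : ℕ → ℤ → Prop} {a b a' b' : ℤ}

theorem flood_mono {s t : ℕ} (h : s ≤ t) {i : ℤ} (hs : flood act a b s i) :
    flood act a b t i := by
  induction t, h using Nat.le_induction with
  | base => exact hs
  | succ t _ ih => exact Or.inl ih

theorem flood_of_outside {i : ℤ} (h : i < a ∨ b ≤ i) (t : ℕ) : flood act a b t i :=
  flood_mono (Nat.zero_le t) (by exact h)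

theorem activity_mono {s t : ℕ} (h : s ≤ t) (i : ℤ) : activity act s i ≤ activity act t i := by
  classical
  unfold activity
  exact Nat.count_monotone (fun s => act s i) h

theorem activity_congr {t : ℕ} {i j : ℤ} (h : ∀ s < t, act s i ↔ act' s j) :
    activity act t i = activity act' t j := by
  classical
  unfold activity
  induction t with
  | zero => simp
  | succ t ih =>
    simp only [Nat.count_succ, ih fun s hs => h s (by omega), h t (by omega)]

/-- A first slot in which the information reaches `i`. -/
theorem exists_first_flood {t : ℕ} {i : ℤ} (h : flood act a b t i) :
    ∃ s ≤ t, flood act a b s i ∧ ∀ r < s, ¬ flood act a b r i := by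
  classical
  have hex : ∃ s, flood act a b s i := ⟨t, h⟩
  exact ⟨Nat.find hex, Nat.find_min' hex h, Nat.find_spec hex, fun r hr => Nat.find_min hex hr⟩

/-- Shrinking the segment enlarges the outside. The activities have to agree only ahead of the inner
flood, since behind it there is nothing left to prove. -/
theorem flood_subset
    (hagree : ∀ t i, ¬ flood act' a' b' t i → (act t i ↔ act' t i))
    (ha : a ≤ a') (hb : b' ≤ b) :
    ∀ t i, flood act a b t i → flood act' a' b' t i := by
  intro t
  induction t with
  | zero =>
    rintro i (h | h)
    · exact Or.inl (by omega)
    · exact Or.inr (by omega)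
  | succ t ih =>
    rintro i (h | ⟨h1, h2⟩)
    · exact Or.inl (ih i h)
    · by_cases hf : flood act' a' b' t i
      · exact Or.inl hf
      · exact Or.inr ⟨(hagree t i hf).1 h1, h2.imp (ih _) (ih _)⟩

/-- Take the first slot in which the flood reaches `i`: before it the two activities at `i`
coincide. -/
theorem exists_flood_activity_le
    (hagree : ∀ t i, ¬ flood act' a' b' t i → (act t i ↔ act' t i))
    {t : ℕ} {i : ℤ} (h : flood act' a' b' t i) :
    ∃ s, flood act' a' b' s i ∧ activity act' s i ≤ activity act t i := by
  obtain ⟨s, hst, hs, hmin⟩ := exists_first_flood h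
  refine ⟨s, hs, ?_⟩
  rw [← activity_congr fun r hr => hagree r i (hmin r hr)]
  exact activity_mono hst i

/-- A subsegment that is not covered in a run of its own keeps an uninformed vertex as long as
every vertex has been active at most `k` times. -/
theorem exists_not_flood_of_not_covered
    (hagree : ∀ t i, ¬ flood act' a' b' t i → (act t i ↔ act' t i))
    (ha : a ≤ a') (hb : b' ≤ b) {k : ℕ} (hcov : ¬ Covered act' a' b' k) {T : ℕ}
    (hT : ∀ i, activity act T i ≤ k) :
    ∃ i, a' ≤ i ∧ i < b' ∧ ¬ flood act a b T i := by
  by_contra! hall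
  refine hcov fun i hi1 hi2 => ?_
  obtain ⟨s, hs, hle⟩ := exists_flood_activity_le hagree
    (flood_subset hagree ha hb T i (hall i hi1 hi2))
  exact ⟨s, hs, hle.trans (hT i)⟩

/-- News can enter the stretch only through `u` or `w`, and both stay uninformed up to slot `T`. -/
theorem not_flood_between {u w : ℤ} {T : ℕ} (hu : ¬ flood act a b T u)
    (hw : ¬ flood act a b T w) :
    ∀ t ≤ T, ∀ i, u ≤ i → i ≤ w → ¬ flood act a b t i := by
  have inside : ∀ x, ¬ flood act a b T x → a ≤ x ∧ x < b := fun x hx => by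
    by_contra hc
    exact hx (flood_of_outside (by omega) T)
  intro t
  induction t with
  | zero =>
    rintro - i h1 h2 (h | h)
    · have := (inside u hu).1
      omega
    · have := (inside w hw).2
      omega
  | succ t ih =>
    rintro ht i h1 h2 (h | ⟨hact, h⟩)
    · exact ih (by omega) i h1 h2 h
    · rcases eq_or_lt_of_le h1 with rfl | h1
      · exact hu (flood_mono ht (Or.inr ⟨hact, h⟩))
      rcases eq_or_lt_of_le h2 with rfl | h2
      · exact hw (flood_mono ht (Or.inr ⟨hact, h⟩))
      rcases h with h | h
      · exact ih (by omega) _ (by omega) (by omega) h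
      · exact ih (by omega) _ (by omega) (by omega) h

/-- Among all vertices, `i` is one of the first that are active for the `(k + 1)`-st time. -/
def IsFirst (act : ℕ → ℤ → Prop) (k : ℕ) (i : ℤ) : Prop :=
  ∃ t, k < activity act (t + 1) i ∧ ∀ j, activity act t j ≤ k

theorem exists_isFirst {k t : ℕ} {i : ℤ} (h : k < activity act t i) :
    ∃ j, IsFirst act k j := by
  classical
  have hex : ∃ t, ∃ j, k < activity act t j := ⟨t, i, h⟩
  obtain ⟨j, hj⟩ := Nat.find_spec hex
  rcases hT : Nat.find hex with _ | T
  · rw [hT] at hj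
    simp [activity] at hj
  · rw [hT] at hj
    refine ⟨j, T, hj, fun l => ?_⟩
    have := Nat.find_min hex (m := T) (by omega)
    push Not at this
    exact this l

/-- The heart of the induction: `i` wastes its `(k + 1)`-st active slot, because uninformed vertices
on both sides still shield it and its neighbours. -/
theorem not_covered_succ_of_isFirst {act₁ act₂ : ℕ → ℤ → Prop} {a₁ b₁ a₂ b₂ : ℤ} {k : ℕ}
    (h₁ : ∀ t i, ¬ flood act₁ a₁ b₁ t i → (act t i ↔ act₁ t i))
    (h₂ : ∀ t i, ¬ flood act₂ a₂ b₂ t i → (act t i ↔ act₂ t i))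
    (ha₁ : a ≤ a₁) (hb₁ : b₁ ≤ b) (ha₂ : a ≤ a₂) (hb₂ : b₂ ≤ b)
    (hc₁ : ¬ Covered act₁ a₁ b₁ k) (hc₂ : ¬ Covered act₂ a₂ b₂ k)
    {i : ℤ} (hi₁ : b₁ ≤ i) (hi₂ : i < a₂) (hi : IsFirst act k i) :
    ¬ Covered act a b (k + 1) := by
  classical
  obtain ⟨T, hT1, hT⟩ := hi
  obtain ⟨u, hu1, hu2, hu⟩ := exists_not_flood_of_not_covered h₁ ha₁ hb₁ hc₁ hT
  obtain ⟨w, hw1, hw2, hw⟩ := exists_not_flood_of_not_covered h₂ ha₂ hb₂ hc₂ hT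
  have hbet := not_flood_between hu hw
  intro hcov
  have hin : ¬ flood act a b (T + 1) i := by
    rintro (h | ⟨-, h | h⟩)
    · exact hbet T le_rfl i (by omega) (by omega) h
    · exact hbet T le_rfl _ (by omega) (by omega) h
    · exact hbet T le_rfl _ (by omega) (by omega) h
  obtain ⟨t, ht, hle⟩ := hcov i (by omega) (by omega)
  obtain ⟨s, hst, hs, hmin⟩ := exists_first_flood ht
  have hsT : T + 1 < s := by
    by_contra hc
    exact hin (flood_mono (by omega) hs)
  obtain ⟨r, rfl⟩ : ∃ r, s = r + 1 := ⟨s - 1, by omega⟩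
  rcases hs with hs | ⟨hact, -⟩
  · exact hmin r (by omega) hs
  -- The arrival slot `r ≥ T + 1` is active too and comes after the more than `k` active slots up to
  -- `T`, so at least `k + 2` are used.
  · have e1 : activity act (r + 1) i = activity act r i + 1 := by
      simp [activity, Nat.count_succ, hact]
    have e2 := activity_mono (act := act) (show T + 1 ≤ r by omega) i
    have e3 := activity_mono (act := act) hst i
    omega

/-- Here `l` plays no role beyond ensuring that the flood arrives everywhere; the count comes from
`hle`. -/
theorem covered_of_activity_le
    (h₁ : ∀ t i, ¬ flood act' a' b' t i → (act t i ↔ act' t i))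
    (ha : a ≤ a') (hb : b' ≤ b) {k l : ℕ} (hcov : Covered act a b l)
    (hle : ∀ t i, activity act t i ≤ k) : Covered act' a' b' k := by
  intro i hi1 hi2
  obtain ⟨t, ht, -⟩ := hcov i (by omega) (by omega)
  obtain ⟨s, hs, hs'⟩ := exists_flood_activity_le h₁ (flood_subset h₁ ha hb t i ht)
  exact ⟨s, hs, hs'.trans (hle t i)⟩

end Flood

end RadioLocal

/-! ### Source-free runs on the line -/

namespace RadioLocal

/-- The feedback to a vertex that acts as `c` between neighbours that act as `l` and `r`. -/
def lineFeedback {Msg : Type*} (l c r : Action Msg) : Option (Multiset Msg) :=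
  match c with
  | .listen => some (({l, r} : Multiset (Action Msg)).filterMap Action.sent)
  | .send _ => none
  | .idle => none

namespace Algorithm

variable {R M Msg : Type*} [MeasurableSpace R] (A : Algorithm R M Msg)

/-- The histories on the infinite line without a source. -/
def lineHist (w : ℤ → R) : ℕ → ℤ → History Msg
  | 0, _ => []
  | t + 1, i => lineHist w t i ++
      [lineFeedback (A.act (w (i - 1)) none (lineHist w t (i - 1)))
        (A.act (w i) none (lineHist w t i))
        (A.act (w (i + 1)) none (lineHist w t (i + 1)))]

/-- Activity on the infinite line without a source. -/
def lineAct (w : ℤ → R) (t : ℕ) (i : ℤ) : Prop :=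
  A.act (w i) none (A.lineHist w t i) ≠ .idle

/-- Histories `h` and actions `c` that obey the algorithm on the segment `[a, b)`. -/
structure IsRunOn (w : ℤ → R) (a b : ℤ) (h : ℕ → ℤ → History Msg) (c : ℕ → ℤ → Action Msg) :
    Prop where
  zero : ∀ i, a ≤ i → i < b → h 0 i = []
  succ : ∀ t i, a ≤ i → i < b →
    h (t + 1) i = h t i ++ [lineFeedback (c t (i - 1)) (c t i) (c t (i + 1))]
  act : ∀ t i, a ≤ i → i < b → c t i = A.act (w i) none (h t i)

variable {A}

theorem isRunOn_lineHist (w : ℤ → R) (a b : ℤ) :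
    A.IsRunOn w a b (A.lineHist w) fun t i => A.act (w i) none (A.lineHist w t i) :=
  ⟨fun _ _ _ => rfl, fun _ _ _ _ => rfl, fun _ _ _ _ => rfl⟩

/-- A run on a segment looks like the source-free run wherever no information from outside has
arrived. -/
theorem IsRunOn.eq_lineHist {w w' : ℤ → R} {a b : ℤ} {h : ℕ → ℤ → History Msg}
    {c : ℕ → ℤ → Action Msg} (hr : A.IsRunOn w a b h c) (hw : ∀ i, a ≤ i → i < b → w i = w' i) :
    ∀ t i, ¬ flood (A.lineAct w') a b t i → h t i = A.lineHist w' t i := by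
  have inside : ∀ t i, ¬ flood (A.lineAct w') a b t i → a ≤ i ∧ i < b := fun t i hi => by
    by_contra hc
    exact hi (flood_of_outside (by omega) t)
  intro t
  induction t with
  | zero => exact fun i hi => hr.zero i (inside 0 i hi).1 (inside 0 i hi).2
  | succ t ih =>
    intro i hi
    obtain ⟨hi1, hi2⟩ := inside _ i hi
    have hit : ¬ flood (A.lineAct w') a b t i := fun hc => hi (Or.inl hc)
    have hact : ∀ j, ¬ flood (A.lineAct w') a b t j →
        c t j = A.act (w' j) none (A.lineHist w' t j) := fun j hj => by
      obtain ⟨hj1, hj2⟩ := inside _ j hj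
      rw [hr.act t j hj1 hj2, hw j hj1 hj2, ih j hj]
    rw [hr.succ t i hi1 hi2, lineHist, ih i hit, hact i hit]
    congr 2
    -- An idle vertex gets no feedback, so informed neighbours cannot disturb it. An active one that
    -- stays unflooded has two unflooded neighbours.
    by_cases hidle : A.act (w' i) none (A.lineHist w' t i) = .idle
    · rw [hidle]; rfl
    · have hl : ¬ flood (A.lineAct w') a b t (i - 1) := fun hc => hi (Or.inr ⟨hidle, Or.inl hc⟩)
      have hrr : ¬ flood (A.lineAct w') a b t (i + 1) := fun hc => hi (Or.inr ⟨hidle, Or.inr hc⟩)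
      rw [hact _ hl, hact _ hrr]

theorem lineAct_congr {w w' : ℤ → R} {a b : ℤ} (hw : ∀ i, a ≤ i → i < b → w i = w' i) (t : ℕ)
    (i : ℤ) (hi : ¬ flood (A.lineAct w') a b t i) : A.lineAct w t i ↔ A.lineAct w' t i := by
  have h1 := (isRunOn_lineHist (A := A) w a b).eq_lineHist hw t i hi
  have h2 : a ≤ i ∧ i < b := by
    by_contra hc
    exact hi (flood_of_outside (by omega) t)
  unfold lineAct
  rw [h1, hw i h2.1 h2.2]

theorem lineHist_shift (w : ℤ → R) (d : ℤ) (t : ℕ) (i : ℤ) :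
    A.lineHist (fun j => w (j + d)) t i = A.lineHist w t (i + d) := by
  induction t generalizing i with
  | zero => rfl
  | succ t ih =>
    simp only [lineHist, ih]
    simp only [sub_add_eq_add_sub, add_right_comm]

theorem lineAct_shift (w : ℤ → R) (d : ℤ) (t : ℕ) (i : ℤ) :
    A.lineAct (fun j => w (j + d)) t i ↔ A.lineAct w t (i + d) := by
  simp only [lineAct, lineHist_shift]

end Algorithm

theorem activity_shift {act act' : ℕ → ℤ → Prop} {d : ℤ}
    (h : ∀ t i, act t i ↔ act' t (i + d)) (t : ℕ) (i : ℤ) :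
    activity act t i = activity act' t (i + d) :=
  activity_congr fun s _ => h s i

theorem flood_shift {act act' : ℕ → ℤ → Prop} {a b d : ℤ}
    (h : ∀ t i, act t i ↔ act' t (i + d)) (t : ℕ) (i : ℤ) :
    flood act a b t i ↔ flood act' (a + d) (b + d) t (i + d) := by
  induction t generalizing i with
  | zero => simp [flood]
  | succ t ih =>
    simp only [flood, ih, h]
    simp only [sub_add_eq_add_sub, add_right_comm]

theorem covered_shift {act act' : ℕ → ℤ → Prop} {a b d : ℤ}
    (h : ∀ t i, act t i ↔ act' t (i + d)) (k : ℕ) :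
    Covered act a b k ↔ Covered act' (a + d) (b + d) k := by
  unfold Covered
  simp only [flood_shift h, activity_shift h]
  refine ⟨fun H i h1 h2 => ?_, fun H i h1 h2 => H (i + d) (by omega) (by omega)⟩
  simpa using H (i - d) (by omega) (by omega)

theorem isFirst_shift {act act' : ℕ → ℤ → Prop} {d : ℤ}
    (h : ∀ t i, act t i ↔ act' t (i + d)) (k : ℕ) (i : ℤ) :
    IsFirst act k i ↔ IsFirst act' k (i + d) := by
  unfold IsFirst
  simp only [activity_shift h]
  refine exists_congr fun t => and_congr_right fun _ => ⟨fun H j => ?_, fun H j => H _⟩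
  simpa using H (j - d)

end RadioLocal

/-! ### Measurability -/

namespace RadioLocal

section Measurability

variable {Ω : Type*} [MeasurableSpace Ω] {act : Ω → ℕ → ℤ → Prop}

theorem measurable_flood (h : ∀ t i, Measurable fun ω => act ω t i) (a b : ℤ) (t : ℕ) (i : ℤ) :
    Measurable fun ω => flood (act ω) a b t i := by
  induction t generalizing i with
  | zero => exact measurable_const
  | succ t ih => exact (ih i).or ((h t i).and ((ih _).or (ih _)))

theorem measurable_activity_le (h : ∀ t i, Measurable fun ω => act ω t i) (t : ℕ) (i : ℤ)
    (k : ℕ) : Measurable fun ω => activity (act ω) t i ≤ k := by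
  classical
  induction t generalizing k with
  | zero => simp [activity]
  | succ t ih =>
    -- The conjunct `1 ≤ k` guards against the truncated subtraction `k - 1`.
    have : (fun ω => activity (act ω) (t + 1) i ≤ k) = fun ω =>
        (act ω t i ∧ (activity (act ω) t i ≤ k - 1 ∧ 1 ≤ k)) ∨
          (¬ act ω t i ∧ activity (act ω) t i ≤ k) := by
      funext ω
      by_cases hc : act ω t i
      · simp only [activity, Nat.count_succ, hc, if_true, true_and, not_true, false_and, or_false,
          eq_iff_iff]
        omega
      · simp [activity, Nat.count_succ, hc]
    rw [this]
    exact ((h t i).and ((ih _).and measurable_const)).or ((h t i).not.and (ih k))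

theorem measurable_covered (h : ∀ t i, Measurable fun ω => act ω t i) (a b : ℤ) (k : ℕ) :
    Measurable fun ω => Covered (act ω) a b k :=
  Measurable.forall fun i => measurable_const.imp <| measurable_const.imp <|
    Measurable.exists fun t => (measurable_flood h a b t i).and (measurable_activity_le h t i k)

theorem measurable_isFirst (h : ∀ t i, Measurable fun ω => act ω t i) (k : ℕ) (i : ℤ) :
    Measurable fun ω => IsFirst (act ω) k i := by
  unfold IsFirst
  simp only [← not_le]
  exact Measurable.exists fun t => (measurable_activity_le h (t + 1) i k).not.and <|
    Measurable.forall fun j => measurable_activity_le h t j k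

/-- Histories and actions carry no σ-algebra; measurability is expressed through fibres, which
suffices because there are countably many values. -/
theorem measurableSet_mem_of_countable {α : Type*} [Countable α] {X : Ω → α}
    (h : ∀ a, MeasurableSet {ω | X ω = a}) (s : Set α) : MeasurableSet {ω | X ω ∈ s} := by
  have : {ω | X ω ∈ s} = ⋃ a ∈ s, {ω | X ω = a} := by
    ext ω
    simp
  rw [this]
  exact MeasurableSet.biUnion s.to_countable fun a _ => h a

theorem measurableSet_eq_prod {α β : Type*} {X : Ω → α} {Y : Ω → β}
    (hX : ∀ a, MeasurableSet {ω | X ω = a}) (hY : ∀ b, MeasurableSet {ω | Y ω = b}) (p : α × β) :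
    MeasurableSet {ω | (X ω, Y ω) = p} := by
  have : {ω | (X ω, Y ω) = p} = {ω | X ω = p.1} ∩ {ω | Y ω = p.2} := by
    ext ω
    simp [Prod.ext_iff]
  rw [this]
  exact (hX _).inter (hY _)

instance {Msg : Type*} [Countable Msg] : Countable (Action Msg) := by
  refine Function.Injective.countable (β := Option (Option Msg))
    (f := fun c => match c with
      | .send a => some (some a)
      | .listen => some none
      | .idle => none) ?_
  rintro (a | _ | _) (b | _ | _) h <;> simp_all

variable {R M Msg : Type*} [MeasurableSpace R] {A : Algorithm R M Msg}

theorem Algorithm.measurableSet_act_comp [Countable Msg] {r : Ω → R} (hr : Measurable r)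
    {h : Ω → History Msg} (hh : ∀ l, MeasurableSet {ω | h ω = l}) (x : Option M)
    (c : Action Msg) : MeasurableSet {ω | A.act (r ω) x (h ω) = c} := by
  have : {ω | A.act (r ω) x (h ω) = c} =
      ⋃ l, {ω | h ω = l} ∩ r ⁻¹' {y | A.act y x l = c} := by
    ext ω
    simp
  rw [this]
  exact MeasurableSet.iUnion fun l => (hh l).inter (hr (A.measurableSet_act x l c))

theorem Algorithm.measurableSet_out_comp [Countable Msg] {r : Ω → R} (hr : Measurable r)
    {h : Ω → History Msg} (hh : ∀ l, MeasurableSet {ω | h ω = l}) (x : Option M)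
    (o : Option M) : MeasurableSet {ω | A.out (r ω) x (h ω) = o} := by
  have : {ω | A.out (r ω) x (h ω) = o} =
      ⋃ l, {ω | h ω = l} ∩ r ⁻¹' {y | A.out y x l = o} := by
    ext ω
    simp
  rw [this]
  exact MeasurableSet.iUnion fun l => (hh l).inter (hr (A.measurableSet_out x l o))

theorem Algorithm.measurableSet_lineHist [Countable Msg] {w : Ω → ℤ → R}
    (hw : ∀ i, Measurable fun ω => w ω i) (t : ℕ) (i : ℤ) (l : History Msg) :
    MeasurableSet {ω | A.lineHist (w ω) t i = l} := by
  induction t generalizing i l with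
  | zero => exact MeasurableSet.const ([] = l)
  | succ t ih =>
    have hact := fun j => A.measurableSet_act_comp (hw j) (ih j) none
    exact measurableSet_mem_of_countable
      (measurableSet_eq_prod (ih i) (measurableSet_eq_prod (hact (i - 1))
        (measurableSet_eq_prod (hact i) (hact (i + 1)))))
      {p | p.1 ++ [lineFeedback p.2.1 p.2.2.1 p.2.2.2] = l}

theorem Algorithm.measurable_lineAct [Countable Msg] {w : Ω → ℤ → R}
    (hw : ∀ i, Measurable fun ω => w ω i) (t : ℕ) (i : ℤ) :
    Measurable fun ω => A.lineAct (w ω) t i :=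
  Measurable.not (measurableSet_setOfPred.1
    (A.measurableSet_act_comp (hw i) (A.measurableSet_lineHist hw t i) none .idle))

end Measurability

/-! ### Rotation invariance and independent blocks -/

section Probability

variable {R : Type*} [MeasurableSpace R]

/-- If at most `B` rotations of every configuration on a cycle lie in `G`, then `G` has
probability at most `B / N`. -/
theorem mul_measure_le_of_rotations (ρ : Measure R) [IsProbabilityMeasure ρ] {N B : ℕ} [NeZero N]
    {G : Set (ZMod N → R)} (hG : MeasurableSet G)
    (h : ∀ ω : ZMod N → R, {c : ZMod N | (fun u => ω (u + c)) ∈ G}.ncard ≤ B) :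
    N * Measure.infinitePi (fun _ : ZMod N => ρ) G ≤ B := by
  classical
  set μ := Measure.infinitePi (fun _ : ZMod N => ρ) with hμ
  have hrot : ∀ c : ZMod N, Measurable fun (ω : ZMod N → R) u => ω (u + c) := fun c => by fun_prop
  have hinv : ∀ c : ZMod N, μ ((fun ω u => ω (u + c)) ⁻¹' G) = μ G := fun c => by
    rw [← Measure.map_apply (hrot c) hG, hμ,
      Measure.map_infinitePi_infinitePi_of_inj (f := fun u : ZMod N => u + c)
        (P := fun _ : ZMod N => ρ) (add_left_injective c)]
  -- Double counting: every rotation preserves the measure, and each configuration has at most `B`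
  -- rotations in `G`.
  calc N * μ G = ∑ c : ZMod N, μ ((fun ω u => ω (u + c)) ⁻¹' G) := by
        simp [hinv, ZMod.card]
    _ = ∑ c : ZMod N, ∫⁻ ω, ((fun ω u => ω (u + c)) ⁻¹' G).indicator 1 ω ∂μ := by
        refine Finset.sum_congr rfl fun c _ => ?_
        rw [lintegral_indicator_one (hrot c hG)]
    _ = ∫⁻ ω, ∑ c : ZMod N, ((fun ω u => ω (u + c)) ⁻¹' G).indicator 1 ω ∂μ := by
        rw [lintegral_finsetSum _ fun c _ => measurable_one.indicator (hrot c hG)]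
    _ ≤ ∫⁻ _, B ∂μ := by
        refine lintegral_mono fun ω => ?_
        have := h ω
        rw [Set.ncard_eq_toFinset_card'] at this
        simp only [Set.indicator_apply, Set.mem_preimage, Pi.one_apply, Finset.sum_boole]
        refine Nat.cast_le.2 (le_trans (le_of_eq ?_) this)
        congr 1
        ext c
        simp
    _ = B := by simp

/-- The configuration on the `j`-th block of length `L` of a cycle. -/
def block {N : ℕ} (L j : ℕ) (ω : ZMod N → R) : ZMod L → R :=
  fun u => ω ((j * L + u.val : ℕ) : ZMod N)

/-- The blocks read disjoint sets of coordinates; `hs` prevents them from wrapping around the cycle.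
-/
theorem measure_three_blocks (ρ : Measure R) [IsProbabilityMeasure ρ] {N L s : ℕ} [NeZero L]
    (hs : (s + 3) * L ≤ N) {C : Set (ZMod L → R)} (hC : MeasurableSet C) :
    Measure.infinitePi (fun _ : ZMod N => ρ) {ω | ∀ j : Fin 3, block L (s + j) ω ∈ C} =
      Measure.infinitePi (fun _ : ZMod L => ρ) C ^ 3 := by
  let g : Fin 3 × ZMod L → ZMod N := fun p => (((s + p.1) * L + p.2.val : ℕ) : ZMod N)
  have hlt : ∀ p : Fin 3 × ZMod L, (s + p.1) * L + p.2.val < N := fun p => by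
    have h1 := ZMod.val_lt p.2
    have h2 := Nat.mul_le_mul_right L (show s + p.1.val + 1 ≤ s + 3 by omega)
    rw [add_mul, one_mul] at h2
    omega
  have hg : Function.Injective g := by
    intro p q hpq
    have h := congrArg ZMod.val hpq
    simp only [g, ZMod.val_natCast_of_lt (hlt _)] at h
    have h1 := ZMod.val_lt p.2
    have h2 := ZMod.val_lt q.2
    have hd := congrArg (· / L) h
    have hm := congrArg (· % L) h
    have hL : 0 < L := Nat.pos_of_ne_zero (NeZero.ne L)
    simp only [Nat.mul_add_mod', Nat.mod_eq_of_lt h1,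
      Nat.mod_eq_of_lt h2] at hm
    simp only [mul_comm _ L, Nat.mul_add_div hL, Nat.div_eq_of_lt h1, Nat.div_eq_of_lt h2] at hd
    exact Prod.ext (Fin.ext (by omega)) (ZMod.val_injective L hm)
  have hcurry := Measure.infinitePi_map_curry (ι := Fin 3) (κ := ZMod L) (fun _ _ => ρ)
  have hset : MeasurableSet (Set.univ.pi fun _ : Fin 3 => C) :=
    MeasurableSet.pi Set.countable_univ fun _ _ => hC
  have hmg : Measurable fun (ω : ZMod N → R) p => ω (g p) := by fun_prop
  rw [← Measure.map_infinitePi_infinitePi_of_inj (f := g) (P := fun _ : ZMod N => ρ) hg,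
    Measure.map_map (by fun_prop) hmg] at hcurry
  have := congrArg (fun ν => ν (Set.univ.pi fun _ : Fin 3 => C)) hcurry
  rw [Measure.map_apply (by fun_prop) hset, Measure.infinitePi_eq_pi (ι := Fin 3), Measure.pi_pi] at this
  simp only [Finset.prod_const, Finset.card_univ, Fintype.card_fin] at this
  rw [← this]
  congr 1
  ext ω
  exact ⟨fun h j _ => h j, fun h j => h j trivial⟩

end Probability

end RadioLocal

/-! ### The recursion on cycles -/

namespace RadioLocal

namespace Algorithm

variable {R M Msg : Type*} [MeasurableSpace R] (A : Algorithm R M Msg)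

/-- The source-free run on a cycle of length `N`, unrolled to the line. -/
def cycleAct {N : ℕ} (ω : ZMod N → R) : ℕ → ℤ → Prop :=
  A.lineAct fun i => ω i

theorem measurable_cycleAct [Countable Msg] {N : ℕ} (t : ℕ) (i : ℤ) :
    Measurable fun ω : ZMod N → R => A.cycleAct ω t i :=
  measurable_lineAct (fun i => measurable_pi_apply (i : ZMod N)) t i

theorem isFirst_cycleAct_rotate {N : ℕ} [NeZero N] (ω : ZMod N → R) (c : ZMod N) (k : ℕ)
    (z : ZMod N) : IsFirst (A.cycleAct fun u => ω (u + c)) k z.val ↔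
      IsFirst (A.cycleAct ω) k ((z + c).val : ℕ) := by
  have hshift : ∀ (d : ℤ) (t : ℕ) (i : ℤ),
      A.cycleAct (fun u => ω (u + (d : ZMod N))) t i ↔ A.cycleAct ω t (i + d) := fun d t i => by
    simpa [cycleAct] using lineAct_shift (A := A) (fun i => ω i) d t i
  -- This integer lift of `c` sends `z.val` to the standard representative of `z + c` even when the
  -- rotation wraps around.
  have hd : ((((z + c).val : ℤ) - z.val : ℤ) : ZMod N) = c := by simp
  have := isFirst_shift (hshift (((z + c).val : ℤ) - z.val)) k z.val
  rwa [hd, add_sub_cancel] at this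

theorem isFirst_cycleAct_iff_val {N : ℕ} [NeZero N] (ω : ZMod N → R) (k : ℕ) (i : ℤ) :
    IsFirst (A.cycleAct ω) k i ↔ IsFirst (A.cycleAct ω) k ((i : ZMod N).val : ℕ) := by
  have hshift : ∀ (t : ℕ) (j : ℤ),
      A.cycleAct ω t j ↔ A.cycleAct ω t (j + (((i : ZMod N).val : ℤ) - i)) := fun t j => by
    have := lineAct_shift (A := A) (fun i => ω i) (((i : ZMod N).val : ℤ) - i) t j
    simpa [cycleAct] using this
  have := isFirst_shift hshift k i
  rwa [add_sub_cancel] at this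

/-- The source-free run on a block of a cycle, closed up to a cycle of its own and moved to its
position in the large cycle, looks like the large run as long as nothing enters the block. -/
theorem cycleAct_block {N L : ℕ} [NeZero L] (ω : ZMod N → R) (j t : ℕ) (i : ℤ)
    (hi : ¬ flood (A.lineAct fun i => block L j ω ((i - j * L : ℤ) : ZMod L))
      (j * L) ((j + 1) * L) t i) :
    A.cycleAct ω t i ↔ A.lineAct (fun i => block L j ω ((i - j * L : ℤ) : ZMod L)) t i := by
  refine lineAct_congr (fun i h1 h2 => ?_) t i hi
  simp only [block]
  congr 1
  have h3 : (((i - j * L : ℤ) : ZMod L).val : ℤ) = i - j * L := by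
    rw [ZMod.val_intCast, Int.emod_eq_of_lt (by omega) (by linarith)]
  have h4 : ((j * L + ((i - j * L : ℤ) : ZMod L).val : ℕ) : ℤ) = i := by
    rw [Nat.cast_add, Nat.cast_mul, h3]
    ring
  rw [← Int.cast_natCast (R := ZMod N), h4]

theorem covered_block {N L : ℕ} [NeZero L] (ω : ZMod N → R) (j k : ℕ) :
    Covered (A.lineAct fun i => block L j ω ((i - j * L : ℤ) : ZMod L)) (j * L) ((j + 1) * L) k ↔
      Covered (A.cycleAct (block L j ω)) 0 L k := by
  have := covered_shift (a := 0) (b := L) (d := j * L)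
    (act := A.cycleAct (block L j ω))
    (act' := A.lineAct fun i => block L j ω ((i - j * L : ℤ) : ZMod L))
    (fun t i => by
      have := lineAct_shift (A := A)
        (fun i => block L j ω ((i - j * L : ℤ) : ZMod L)) (j * L) t i
      rw [← this]
      simp only [add_sub_cancel_right]
      rfl) k
  rw [this, zero_add, add_mul, one_mul, add_comm]

/-- If the run on a cycle of `32` blocks is covered within `k + 1` active slots, then one of
three things has happened: the first three blocks are covered within `k` active slots by
themselves, or the last three are, or no vertex of the middle blocks is among the first to be
active for the `(k + 1)`-st time. -/
theorem covered_succ_cases {L : ℕ} [NeZero L] (ω : ZMod (32 * L) → R) (k : ℕ)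
    (h : Covered (A.cycleAct ω) 0 (32 * L : ℕ) (k + 1)) :
    (∀ j : Fin 3, Covered (A.cycleAct (block L (0 + j) ω)) 0 L k) ∨
    (∀ j : Fin 3, Covered (A.cycleAct (block L (29 + j) ω)) 0 L k) ∨
    ((∃ i, IsFirst (A.cycleAct ω) k i) ∧
      ∀ i : ℤ, 3 * L ≤ i → i < 29 * L → ¬ IsFirst (A.cycleAct ω) k i) := by
  by_contra! hcon
  obtain ⟨⟨j₁, hj₁⟩, ⟨j₂, hj₂⟩, hfirst⟩ := hcon
  rw [← covered_block] at hj₁ hj₂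
  have b₁ := j₁.isLt
  have b₂ := j₂.isLt
  have c₁ : ((0 + j₁ + 1 : ℕ) : ℤ) * L ≤ 3 * L :=
    mul_le_mul_of_nonneg_right (by exact_mod_cast (by omega)) (by positivity)
  have c₂ : 29 * (L : ℤ) ≤ ((29 + j₂ : ℕ) : ℤ) * L :=
    mul_le_mul_of_nonneg_right (by exact_mod_cast (by omega)) (by positivity)
  have c₃ : ((29 + j₂ + 1 : ℕ) : ℤ) * L ≤ 32 * L :=
    mul_le_mul_of_nonneg_right (by exact_mod_cast (by omega)) (by positivity)
  have c₄ : (0 : ℤ) ≤ ((0 + j₁ : ℕ) : ℤ) * L := by positivity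
  push_cast at c₁ c₂ c₃ c₄ hj₁ hj₂ h
  have hL : (0 : ℤ) ≤ L := by positivity
  have hag₁ := A.cycleAct_block (L := L) ω (0 + j₁)
  have hag₂ := A.cycleAct_block (L := L) ω (29 + j₂)
  push_cast at hag₁ hag₂
  by_cases hex : ∃ i, IsFirst (A.cycleAct ω) k i
  · obtain ⟨i, hi1, hi2, hi⟩ := hfirst hex
    exact not_covered_succ_of_isFirst hag₁ hag₂ c₄ (by linarith) (by linarith) c₃ hj₁ hj₂
      (by linarith) (by linarith) hi h
  -- If nobody is ever active `k + 1` times, block `j₁` would be covered within `k` slots. Hence the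
  -- third case may include existence, which the rotation argument needs.
  · refine hj₁ (covered_of_activity_le hag₁ c₄ (by linarith) h fun t i => ?_)
    by_contra! hlt
    exact hex (exists_isFirst hlt)

variable (ρ : Measure R) [IsProbabilityMeasure ρ]

/-- By rotation invariance, the first vertices to be active for the `(k + 1)`-st time avoid the
middle `26` of `32` blocks with probability at most `6 / 32`. -/
theorem measure_no_isFirst_middle_le [Countable Msg] {L : ℕ} [NeZero L] (k : ℕ) :
    Measure.infinitePi (fun _ : ZMod (32 * L) => ρ)
      {ω | (∃ i, IsFirst (A.cycleAct ω) k i) ∧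
        ∀ i : ℤ, 3 * L ≤ i → i < 29 * L → ¬ IsFirst (A.cycleAct ω) k i} ≤ 6 / 32 := by
  have hm := fun i => measurable_isFirst
    (fun t i => A.measurable_cycleAct (N := 32 * L) t i) k i
  have hG : MeasurableSet {ω : ZMod (32 * L) → R | (∃ i, IsFirst (A.cycleAct ω) k i) ∧
      ∀ i : ℤ, 3 * L ≤ i → i < 29 * L → ¬ IsFirst (A.cycleAct ω) k i} :=
    measurableSet_setOfPred.2 <| (Measurable.exists hm).and <| Measurable.forall fun i =>
      measurable_const.imp (measurable_const.imp (hm i).not)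
  have := mul_measure_le_of_rotations ρ (B := 6 * L) hG fun ω => by
    rcases Set.eq_empty_or_nonempty {c : ZMod (32 * L) | (fun u => ω (u + c)) ∈
      {ω : ZMod (32 * L) → R | (∃ i, IsFirst (A.cycleAct ω) k i) ∧
        ∀ i : ℤ, 3 * L ≤ i → i < 29 * L → ¬ IsFirst (A.cycleAct ω) k i}} with he | ⟨c₀, hc₀, -⟩
    · rw [he]
      simp
    obtain ⟨i₀, hi₀⟩ := hc₀
    rw [isFirst_cycleAct_iff_val, isFirst_cycleAct_rotate] at hi₀
    -- `z₀` is a first vertex for `ω` itself, seen at `z₀ - c` after rotation by `c`. In the event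
    -- this point lies in the six outer blocks, leaving at most `6 * L` values of `c`.
    set z₀ := (i₀ : ZMod (32 * L)) + c₀
    have hcard : (Finset.range (3 * L) ∪ Finset.Ico (29 * L) (32 * L)).card ≤ 6 * L := by
      refine (Finset.card_union_le _ _).trans ?_
      simp only [Finset.card_range, Nat.card_Ico]
      omega
    refine le_trans ?_ hcard
    rw [← Set.ncard_coe_finset]
    refine Set.ncard_le_ncard_of_injOn (fun c => (z₀ - c).val) ?_ ?_ (Finset.finite_toSet _)
    · rintro c ⟨-, hc⟩
      have hlt := ZMod.val_lt (z₀ - c)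
      by_contra hmem
      simp only [Finset.coe_union, Finset.coe_range, Finset.coe_Ico, Set.mem_union, Set.mem_Iio,
        Set.mem_Ico, not_or, not_lt, not_and] at hmem
      refine hc (z₀ - c).val (by exact_mod_cast hmem.1) (by
        by_contra hge
        push Not at hge
        have := hmem.2 (by exact_mod_cast hge)
        omega) ?_
      rw [isFirst_cycleAct_rotate, sub_add_cancel]
      exact hi₀
    · intro c _ c' _ hcc
      exact sub_right_injective (ZMod.val_injective _ hcc)
  rw [ENNReal.le_div_iff_mul_le (by simp) (by simp)]
  push_cast at this
  have hL0 : (L : ℝ≥0∞) ≠ 0 := by exact_mod_cast NeZero.ne L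
  rw [mul_right_comm] at this
  have := (ENNReal.mul_le_mul_iff_left hL0 (ENNReal.natCast_ne_top L)).1 this
  rwa [mul_comm]

theorem measure_covered_le [Countable Msg] (k : ℕ) :
    Measure.infinitePi (fun _ : ZMod (32 ^ k) => ρ)
      {ω | Covered (A.cycleAct ω) 0 (32 ^ k : ℕ) k} ≤ 3 / 8 := by
  have hstep : ∀ (L k : ℕ) [NeZero L], Measure.infinitePi (fun _ : ZMod L => ρ)
        {ω | Covered (A.cycleAct ω) 0 L k} ≤ 3 / 8 →
      Measure.infinitePi (fun _ : ZMod (32 * L) => ρ)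
        {ω | Covered (A.cycleAct ω) 0 (32 * L : ℕ) (k + 1)} ≤ 3 / 8 := by
    intro L k _ ih
    have hC : MeasurableSet {ω : ZMod L → R | Covered (A.cycleAct ω) 0 L k} :=
      measurableSet_setOfPred.2 (measurable_covered A.measurable_cycleAct 0 L k)
    have e₁ := measure_three_blocks ρ (N := 32 * L) (s := 0)
      (Nat.mul_le_mul_right L (by norm_num)) hC
    have e₂ := measure_three_blocks ρ (N := 32 * L) (s := 29)
      (Nat.mul_le_mul_right L (by norm_num)) hC
    have e₃ := A.measure_no_isFirst_middle_le ρ (L := L) k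
    calc _ ≤ _ := measure_mono fun ω hω => A.covered_succ_cases ω k hω
      _ ≤ _ := (measure_union_le _ _).trans (add_le_add le_rfl (measure_union_le _ _))
      -- The sum is 75/256. Requiring three blocks at each end makes the induction bound enter
      -- cubed; a single block would give `2 * x`, which cannot close.
      _ ≤ (3 / 8) ^ 3 + ((3 / 8) ^ 3 + 6 / 32) :=
          add_le_add (e₁.le.trans (pow_le_pow_left' ih 3))
            (add_le_add (e₂.le.trans (pow_le_pow_left' ih 3)) e₃)
      _ ≤ 3 / 8 := by
        rw [← ENNReal.toReal_le_toReal (by finiteness) (by finiteness)]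
        rw [ENNReal.toReal_add (by finiteness) (by finiteness),
          ENNReal.toReal_add (by finiteness) (by finiteness)]
        norm_num
  induction k with
  | zero =>
    -- Being reached inside the segment costs an active slot, and none is allowed.
    have : {ω : ZMod (32 ^ 0) → R | Covered (A.cycleAct ω) 0 (32 ^ 0 : ℕ) 0} = ∅ := by
      ext ω
      simp only [Set.mem_ofPred_eq, Set.mem_empty_iff_false, iff_false]
      intro h
      obtain ⟨t, ht, hle⟩ := h 0 le_rfl (by simp)
      obtain ⟨s, hst, hs, hmin⟩ := exists_first_flood ht
      cases s with
      | zero => simp [flood] at hs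
      | succ r =>
        rcases hs with hs | ⟨hact, -⟩
        · exact hmin r (by omega) hs
        · classical
          have e1 : activity (A.cycleAct ω) (r + 1) 0 = activity (A.cycleAct ω) r 0 + 1 := by
            simp [activity, Nat.count_succ, hact]
          have e3 := activity_mono (act := A.cycleAct ω) hst 0
          omega
    rw [this]
    simp
  | succ k ih =>
    have := hstep (32 ^ k) k ih
    rwa [← pow_succ'] at this

end Algorithm

end RadioLocal

/-! ### From the path to the source-free segment -/

namespace RadioLocal

/-- A family on the vertices of a path, extended to the integer line by a default value. -/
def extend {X : Type*} {n : ℕ} (d : X) (f : Fin n → X) (i : ℤ) : X :=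
  if h : 0 ≤ i ∧ i < n then f ⟨i.toNat, by omega⟩ else d

theorem extend_coe {X : Type*} {n : ℕ} (d : X) (f : Fin n → X) (v : Fin n) :
    extend d f v = f v := by
  simp [extend]

/-- The missing neighbours at the ends are replaced by idle ones, which add no message. -/
theorem feedback_pathGraph {Msg : Type*} {n : ℕ} (a : Fin n → Action Msg) (v : Fin n) :
    Algorithm.feedback (SimpleGraph.pathGraph n) a v =
      lineFeedback (extend .idle a (v - 1)) (a v) (extend .idle a (v + 1)) := by
  unfold Algorithm.feedback lineFeedback
  cases hv : a v with
  | send _ => rfl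
  | idle => rfl
  | listen =>
    simp only [Option.some.injEq]
    have hsent : ∀ l r : Action Msg, ({l, r} : Multiset (Action Msg)).filterMap Action.sent =
        (({l} : Multiset (Action Msg)).filterMap Action.sent) +
          (({r} : Multiset (Action Msg)).filterMap Action.sent) := fun l r => by
      rw [← Multiset.filterMap_add]
      rfl
    have hidle : ({Action.idle} : Multiset (Action Msg)).filterMap Action.sent = 0 := rfl
    have hone : ∀ u : Fin n, ({a u} : Multiset (Action Msg)).filterMap Action.sent =
        ({u} : Multiset (Fin n)).filterMap fun u => (a u).sent := fun u => by
      rw [← Multiset.map_singleton, Multiset.filterMap_map]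
      rfl
    rw [hsent]
    have hl : ({extend Action.idle a (v - 1)} : Multiset (Action Msg)).filterMap Action.sent =
        (Finset.univ.filter fun u : Fin n => u.val + 1 = v.val).val.filterMap
          fun u => (a u).sent := by
      by_cases h : 0 < v.val
      · have he : (Finset.univ.filter fun u : Fin n => u.val + 1 = v.val) =
            {⟨v.val - 1, by omega⟩} := by
          ext u
          simp only [Finset.mem_filter, Finset.mem_univ, true_and, Finset.mem_singleton, Fin.ext_iff]
          omega
        have hx : ((v : ℤ) - 1) = ((⟨v.val - 1, by omega⟩ : Fin n) : ℤ) := by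
          simp only
          omega
        rw [he, hx, extend_coe, hone]
        rfl
      · have he : (Finset.univ.filter fun u : Fin n => u.val + 1 = v.val) = ∅ := by
          ext u
          simp only [Finset.mem_filter, Finset.mem_univ, true_and, Finset.notMem_empty, iff_false]
          omega
        rw [he, extend, dif_neg (by omega), hidle]
        rfl
    have hr : ({extend Action.idle a (v + 1)} : Multiset (Action Msg)).filterMap Action.sent =
        (Finset.univ.filter fun u : Fin n => v.val + 1 = u.val).val.filterMap
          fun u => (a u).sent := by
      by_cases h : v.val + 1 < n
      · have he : (Finset.univ.filter fun u : Fin n => v.val + 1 = u.val) =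
            {⟨v.val + 1, h⟩} := by
          ext u
          simp only [Finset.mem_filter, Finset.mem_univ, true_and, Finset.mem_singleton, Fin.ext_iff]
          omega
        have hx : ((v : ℤ) + 1) = ((⟨v.val + 1, h⟩ : Fin n) : ℤ) := by
          simp
        rw [he, hx, extend_coe, hone]
        rfl
      · have he : (Finset.univ.filter fun u : Fin n => v.val + 1 = u.val) = ∅ := by
          ext u
          simp only [Finset.mem_filter, Finset.mem_univ, true_and, Finset.notMem_empty, iff_false]
          omega
        rw [he, extend, dif_neg (by omega), hidle]
        rfl
    have hdisj : Disjoint (Finset.univ.filter fun u : Fin n => u.val + 1 = v.val)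
        (Finset.univ.filter fun u : Fin n => v.val + 1 = u.val) := by
      rw [Finset.disjoint_left]
      intro u h1 h2
      simp only [Finset.mem_filter, Finset.mem_univ, true_and] at h1 h2
      omega
    rw [hl, hr, ← Multiset.filterMap_add]
    congr 1
    rw [← Finset.disjUnion_val _ _ hdisj]
    congr 1
    ext u
    simp only [SimpleGraph.mem_neighborFinset, SimpleGraph.pathGraph_adj, Finset.mem_disjUnion,
      Finset.mem_filter, Finset.mem_univ, true_and]
    exact or_comm

namespace Algorithm

variable {R M Msg : Type*} [MeasurableSpace R] (A : Algorithm R M Msg)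

theorem measurableSet_hist [Countable Msg] {V : Type*} [Fintype V] (G : SimpleGraph V) (src : V)
    (m : M) (t : ℕ) (v : V) (l : History Msg) :
    MeasurableSet {ω : V → R | A.hist G src m ω t v = l} := by
  classical
  induction t generalizing v l with
  | zero => exact MeasurableSet.const ([] = l)
  | succ t ih =>
    have hact : ∀ c : V → Action Msg, MeasurableSet {ω : V → R |
        (fun u => A.act (ω u) (input src m u) (A.hist G src m ω t u)) = c} := fun c => by
      simp only [funext_iff]
      have : Countable V := Finite.to_countable
      exact measurableSet_setOfPred.2 <| Measurable.forall fun u => measurableSet_setOfPred.1 <|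
        A.measurableSet_act_comp (measurable_pi_apply u) (ih u) (input src m u) (c u)
    exact measurableSet_mem_of_countable (measurableSet_eq_prod (ih v) hact)
      {p | p.1 ++ [feedback G p.2 v] = l}

theorem measurableSet_succeeds [Countable Msg] {V : Type*} [Fintype V] (G : SimpleGraph V)
    (src : V) (m : M) : MeasurableSet {ω : V → R | A.Succeeds G src m ω} := by
  have hout : ∀ t v o, Measurable fun ω : V → R => A.outAt G src m ω t v = o := fun t v o =>
    measurableSet_setOfPred.1 (A.measurableSet_out_comp (measurable_pi_apply v)
      (A.measurableSet_hist G src m t v) (input src m v) o)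
  have : Countable V := Finite.to_countable
  exact measurableSet_setOfPred.2 <| Measurable.forall fun v => measurable_const.imp <|
    Measurable.exists fun t => (hout t v _).and <| Measurable.forall fun s =>
      measurable_const.imp (hout s v _)

/-- The random strings of the `L` vertices after the source, closed up to a cycle. -/
def afterSource {n L : ℕ} [NeZero L] (hL : L < n) (ω : Fin n → R) : ZMod L → R :=
  fun u => ω ⟨1 + u.val, by have := ZMod.val_lt u; omega⟩

/-- The segment starts at position 1, so the source and its input belong to the outside, whose
actions are unconstrained. -/
theorem isRunOn_path {n L : ℕ} [NeZero L] (hL : L < n) (hn : 0 < n) (m : M) (ω : Fin n → R) :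
    A.IsRunOn (fun i => afterSource hL ω ((i - 1 : ℤ) : ZMod L)) 1 (L + 1)
      (fun t => extend [] (A.hist (SimpleGraph.pathGraph n) ⟨0, hn⟩ m ω t))
      (fun t => extend .idle (A.actionAt (SimpleGraph.pathGraph n) ⟨0, hn⟩ m ω t)) := by
  have hv : ∀ i : ℤ, 1 ≤ i → i < L + 1 → ∃ v : Fin n, i = v ∧ v ≠ ⟨0, hn⟩ := fun i h1 h2 =>
    ⟨⟨i.toNat, by omega⟩, by simp only; omega, by simp only [ne_eq, Fin.mk.injEq]; omega⟩
  refine ⟨fun i h1 h2 => ?_, fun t i h1 h2 => ?_, fun t i h1 h2 => ?_⟩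
  · obtain ⟨v, rfl, -⟩ := hv i h1 h2
    simp [extend_coe, hist]
  · obtain ⟨v, rfl, -⟩ := hv i h1 h2
    simp only [extend_coe, hist, feedback_pathGraph]
    rfl
  · obtain ⟨v, rfl, hvs⟩ := hv i h1 h2
    have hval : ((((v : ℤ) - 1 : ℤ) : ZMod L).val : ℤ) = v - 1 := by
      rw [ZMod.val_intCast, Int.emod_eq_of_lt (by omega) (by omega)]
    have hω : afterSource hL ω (((v : ℤ) - 1 : ℤ) : ZMod L) = ω v := by
      unfold afterSource
      congr 1
      ext
      simp only
      omega
    simp only [extend_coe]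
    rw [hω, actionAt, input, if_neg hvs]

/-- If a run on the path succeeds for two payloads and no vertex spends more than `k` energy in
one of them before receiving, then the source-free run on the segment after the source is
covered within `k` active slots. -/
theorem covered_of_succeeds {n L : ℕ} [NeZero L] (hL : L < n) (hn : 0 < n) {m m' : M}
    (hm : m ≠ m') (ω : Fin n → R) (k : ℕ)
    (h : A.Succeeds (SimpleGraph.pathGraph n) ⟨0, hn⟩ m ω)
    (h' : A.Succeeds (SimpleGraph.pathGraph n) ⟨0, hn⟩ m' ω)
    (hk : ∀ v, ∀ a : ℕ,
      (a : ℕ∞) ≤ A.energyBeforeReceiving (SimpleGraph.pathGraph n) ⟨0, hn⟩ m ω v → a ≤ k) :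
    Covered (A.cycleAct (afterSource hL ω)) 0 L k := by
  classical
  rw [covered_shift (d := 1)
    (act' := A.lineAct fun i => afterSource hL ω ((i - 1 : ℤ) : ZMod L)) (fun t i => by
      rw [← lineAct_shift]
      simp only [add_sub_cancel_right]
      rfl), zero_add]
  intro i h1 h2
  obtain ⟨v, rfl, hv⟩ : ∃ v : Fin n, i = v ∧ v ≠ ⟨0, hn⟩ :=
    ⟨⟨i.toNat, by omega⟩, by simp only; omega, by simp only [ne_eq, Fin.mk.injEq]; omega⟩
  set act := A.lineAct fun i => afterSource hL ω ((i - 1 : ℤ) : ZMod L) with hact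
  have heq : ∀ (p : M) (t : ℕ), ¬ flood act 1 (L + 1) t v →
      A.hist (SimpleGraph.pathGraph n) ⟨0, hn⟩ p ω t v =
        A.lineHist (fun i => afterSource hL ω ((i - 1 : ℤ) : ZMod L)) t v := fun p t ht => by
    rw [← (A.isRunOn_path hL hn p ω).eq_lineHist (fun _ _ _ => rfl) t v ht, extend_coe]
  obtain ⟨t, ht, htmin⟩ := h v hv
  obtain ⟨t', ht', htmin'⟩ := h' v hv
  -- An unflooded vertex has the same outputs under `m` and `m'`, so its first output could not be
  -- right in both runs.
  have hflood : flood act 1 (L + 1) t v := by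
    by_contra hc
    have hout : ∀ s ≤ t, A.outAt (SimpleGraph.pathGraph n) ⟨0, hn⟩ m ω s v =
        A.outAt (SimpleGraph.pathGraph n) ⟨0, hn⟩ m' ω s v := fun s hs => by
      have hcs : ¬ flood act 1 (L + 1) s v := fun hf => hc (flood_mono hs hf)
      simp only [outAt, heq _ s hcs, input, if_neg hv]
    rcases lt_trichotomy t' t with hlt | rfl | hlt
    · have := htmin t' hlt
      rw [hout t' hlt.le, ht'] at this
      simp at this
    · have := hout t' le_rfl
      rw [ht, ht'] at this
      exact hm (Option.some.inj this)
    · have := htmin' t hlt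
      rw [← hout t le_rfl, ht] at this
      simp at this
  obtain ⟨s, hst, hs, hmin⟩ := exists_first_flood hflood
  refine ⟨s, hs, hk v _ ?_⟩
  rw [activity, Nat.count_eq_card_filter_range, ← Set.encard_coe_eq_coe_finsetCard,
    energyBeforeReceiving]
  -- Active slots before the flood arrives precede the first output at `t`, so all of them count as
  -- energy before receiving.
  refine Set.encard_le_encard fun r hr => ?_
  simp only [Finset.coe_filter, Finset.mem_range, Set.mem_ofPred_eq] at hr
  obtain ⟨hrs, hra⟩ := hr
  have hvω := (A.isRunOn_path hL hn m ω).act r v h1 h2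
  simp only [extend_coe] at hvω
  refine ⟨?_, ?_⟩
  · rw [hvω, heq m r (hmin r hrs)]
    exact hra
  · rintro (hc | ⟨q, hq, hc⟩)
    · exact hv hc
    · rw [htmin q (by omega)] at hc
      simp at hc

theorem measure_covered_afterSource_le [Countable Msg] (ρ : Measure R) [IsProbabilityMeasure ρ]
    {n k : ℕ} (hk : 32 ^ k < n) :
    Measure.pi (fun _ : Fin n => ρ)
      {ω | Covered (A.cycleAct (afterSource hk ω)) 0 (32 ^ k : ℕ) k} ≤ 3 / 8 := by
  have hinj : Function.Injective fun u : ZMod (32 ^ k) =>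
      (⟨1 + u.val, by have := ZMod.val_lt u; omega⟩ : Fin n) := fun u u' h => by
    simp only [Fin.mk.injEq, add_right_inj] at h
    exact ZMod.val_injective _ h
  have hmap := Measure.map_infinitePi_infinitePi_of_inj (P := fun _ : Fin n => ρ) hinj
  have hC := measurableSet_setOfPred.2
    (measurable_covered (A.measurable_cycleAct (N := 32 ^ k)) 0 (32 ^ k : ℕ) k)
  refine le_trans (le_of_eq ?_) (A.measure_covered_le ρ k)
  rw [← hmap, Measure.map_apply (by fun_prop) hC, Measure.infinitePi_eq_pi]
  rfl

end Algorithm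

/-! ### Constants and the union bound -/

theorem le_log_of_lt_logb {n a : ℕ} (h : (a : ℝ≥0∞) < ENNReal.ofReal (1 / 5 * Real.logb 2 n)) :
    a ≤ Nat.log 32 (n - 1) := by
  rw [← ENNReal.ofReal_natCast, ENNReal.ofReal_lt_ofReal_iff_of_nonneg (by positivity)] at h
  have hn : 0 < n := by
    by_contra hc
    obtain rfl : n = 0 := by omega
    simp at h
    linarith [Nat.cast_nonneg (α := ℝ) a]
  -- The factor 1/5 reflects `32 = 2 ^ 5`.
  have h5 : ((5 * a : ℕ) : ℝ) < Real.logb 2 n := by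
    push_cast
    linarith
  rw [Real.lt_logb_iff_rpow_lt (by norm_num) (by exact_mod_cast hn), Real.rpow_natCast,
    pow_mul] at h5
  have h32 : 32 ^ a < n := by
    norm_num at h5
    exact_mod_cast h5
  have hpos : 0 < 32 ^ a := by positivity
  exact Nat.le_log_of_pow_le (by norm_num) (by omega)

end RadioLocal

theorem mainTheorem3 {R M Msg : Type*} [MeasurableSpace R] [Nontrivial M] [Countable Msg]
    (ρ : Measure R) [IsProbabilityMeasure ρ] (n : ℕ) (hn : 0 < n)
    (A : RadioLocal.Algorithm R M Msg)
    (hA : A.SolvesBroadcast (SimpleGraph.pathGraph n) ⟨0, hn⟩ ρ (15 / 16))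
    (m : M) :
    1 / 2 ≤ Measure.pi (fun _ : Fin n => ρ)
      {ω | ∃ v : Fin n, ENNReal.ofReal (1 / 5 * Real.logb 2 n) ≤
        (A.energyBeforeReceiving (SimpleGraph.pathGraph n) ⟨0, hn⟩ m ω v : ℝ≥0∞)} := by
  rcases Nat.lt_or_ge 1 n with hn1 | hn1
  swap
  · obtain rfl : n = 1 := by omega
    simp
  -- The largest `k` for which `32 ^ k` vertices fit after the source.
  set k := Nat.log 32 (n - 1) with hk
  have hkn : 32 ^ k < n := by
    have : 32 ^ k ≤ n - 1 := Nat.pow_log_le_self 32 (by omega)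
    omega
  obtain ⟨m', hm'⟩ := exists_ne m
  set μ := Measure.pi (fun _ : Fin n => ρ) with hμ
  set X := {ω : Fin n → R | ∃ v : Fin n, ENNReal.ofReal (1 / 5 * Real.logb 2 n) ≤
        (A.energyBeforeReceiving (SimpleGraph.pathGraph n) ⟨0, hn⟩ m ω v : ℝ≥0∞)} with hX
  have hfail : ∀ p : M,
      μ {ω | A.Succeeds (SimpleGraph.pathGraph n) ⟨0, hn⟩ p ω}ᶜ ≤ 1 / 16 := fun p => by
    rw [prob_compl_eq_one_sub (A.measurableSet_succeeds _ _ p), tsub_le_iff_right]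
    refine le_trans (le_of_eq ?_) (add_le_add_right (hA p) _)
    rw [← ENNReal.add_div, show (1 + 15 : ℝ≥0∞) = 16 by norm_num,
      ENNReal.div_self (by simp) (by simp)]
  -- The last three events have probabilities at most 1/16, 1/16 and 3/8, which add up to 1/2. Both
  -- payloads are run on the same `ω`.
  have hcover : (Set.univ : Set (Fin n → R)) ⊆ X ∪
      ({ω | A.Succeeds (SimpleGraph.pathGraph n) ⟨0, hn⟩ m ω}ᶜ ∪
      ({ω | A.Succeeds (SimpleGraph.pathGraph n) ⟨0, hn⟩ m' ω}ᶜ ∪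
      {ω | RadioLocal.Covered (A.cycleAct (RadioLocal.Algorithm.afterSource hkn ω)) 0
        (32 ^ k : ℕ) k})) := by
    intro ω _
    by_contra hc
    simp only [Set.mem_union, Set.mem_compl_iff, Set.mem_ofPred_eq, not_or, not_not, hX,
      not_exists, not_le] at hc
    obtain ⟨hE, h1, h2, h3⟩ := hc
    refine h3 (A.covered_of_succeeds hkn hn hm'.symm ω k h1 h2 fun v a ha => ?_)
    refine RadioLocal.le_log_of_lt_logb (lt_of_le_of_lt ?_ (hE v))
    exact_mod_cast ENat.toENNReal_le.2 ha
  have hle : 1 ≤ μ X + (1 / 16 + (1 / 16 + 3 / 8)) := by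
    calc (1 : ℝ≥0∞) = μ Set.univ := measure_univ.symm
      _ ≤ _ := measure_mono hcover
      _ ≤ _ := (measure_union_le _ _).trans (add_le_add le_rfl ((measure_union_le _ _).trans
          (add_le_add (hfail m) ((measure_union_le _ _).trans
            (add_le_add (hfail m') (A.measure_covered_afterSource_le ρ hkn))))))
  have hhalf : (1 / 16 + (1 / 16 + 3 / 8) : ℝ≥0∞) = 1 / 2 := by
    rw [← ENNReal.toReal_eq_toReal_iff' (by finiteness) (by finiteness),
      ENNReal.toReal_add (by finiteness) (by finiteness),
      ENNReal.toReal_add (by finiteness) (by finiteness)]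
    norm_num
  rw [hhalf] at hle
  refine (ENNReal.add_le_add_iff_right (a := 1 / 2) (by finiteness)).1 (le_trans ?_ hle)
  rw [ENNReal.add_halves]
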